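/- Let $V$ be the $\mathbb{Q}$-vector space of all finitely supported sequences of rational numbers, and let $\mathcal{P}$ be the space of all pseudonorms (seminorms) on $V$ with the topology inherited from the product $\mathbb{R}^V$. Each $\mu\in\mathcal{P}$ extends uniquely to a pseudonorm, again denoted $\mu$, on the real vector space $c_{00}$ of finitely supported real sequences; let $X_\mu$ be the Banach space obtained by completing the quotient of $(c_{00},\mu)$ by $\{x\in c_{00}:\mu(x)=0\}$. Let $\mathcal{P}_\infty$ be the set of those $\mu\in\mathcal{P}$ for which $X_\mu$ is infinite-dimensional, and $\mathcal{B}$ the set of those $\mu\in\mathcal{P}_\infty$ whose extension to $c_{00}$ is a norm, both with the subspace topology. Call a real separable Banach space $G$ a Gurari\u{\i} space if for every $\varepsilon>0$, every finite-dimensional Banach space $B$, every subspace $A\subseteq G$ and every linear isometric embedding $g:A\to B$ there is a linear map $f:B\to G$ with $(1+\varepsilon)^{-1}\|x\|\le\|f(x)\|\le(1+\varepsilon)\|x\|$ for all $x\in B$ and $\|f\circ g-\mathrm{id}_A\|\le\varepsilon$. **Theorem.** A Gurari\u{\i} space exists and is unique up to surjective linear isometry; denote it by $\mathbb{G}$.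 For every $\mathcal{I}\in\{\mathcal{P},\mathcal{P}_\infty,\mathcal{B}\}$, the isometry class $$\{\mu\in\mathcal{I}: X_\mu\text{ is linearly isometric to }\mathbb{G}\}$$ (the isometry being surjective) is a dense $G_\delta$ subset of $\mathcal{I}$. -/

import Mathlib

noncomputable section

/-! ### Pseudonorms on the space of finitely supported rational sequences -/

/-- The `ℚ`-vector space `V` of all finitely supported sequences of rational numbers. -/
abbrev RatSeq : Type := ℕ →₀ ℚ

/-- The vector space `c₀₀` of all finitely supported sequences of real numbers. -/
abbrev RealSeq : Type := ℕ →₀ ℝ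

/-- The space `𝓟` of all pseudonorms on the `ℚ`-vector space `V`. -/
abbrev PseudoNorm : Type := Seminorm ℚ RatSeq

/-- The topology of `𝓟` is inherited from the product `ℝ ^ V` (pointwise convergence). -/
instance PseudoNorm.instTopologicalSpace : TopologicalSpace PseudoNorm :=
  TopologicalSpace.induced (fun (μ : PseudoNorm) (v : RatSeq) => μ v) inferInstance

namespace PseudoNorm

/-- The inclusion `V ⊆ c₀₀`. -/
def incl (v : RatSeq) : RealSeq := v.mapRange (fun q : ℚ => (q : ℝ)) Rat.cast_zero

@[simp] theorem incl_apply (v : RatSeq) (i : ℕ) : incl v i = (v i : ℝ) := rfl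

theorem incl_add (v w : RatSeq) : incl (v + w) = incl v + incl w := by
  ext i; simp

theorem incl_smul (q : ℚ) (v : RatSeq) : incl (q • v) = (q : ℝ) • incl v := by
  ext i; simp

/-- The weighted `ℓ₁`-seminorm `x ↦ ∑ᵢ |xᵢ| μ(eᵢ)` on `c₀₀`. -/
def weight (μ : PseudoNorm) (x : RealSeq) : ℝ :=
  x.sum fun i a => |a| * μ (Finsupp.single i (1 : ℚ))

theorem weight_eq_sum (μ : PseudoNorm) (x : RealSeq) (s : Finset ℕ) (hs : x.support ⊆ s) :
    weight μ x = ∑ i ∈ s, |x i| * μ (Finsupp.single i 1) :=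
  Finsupp.sum_of_support_subset x hs _ (by simp)

theorem weight_nonneg (μ : PseudoNorm) (x : RealSeq) : 0 ≤ weight μ x :=
  Finset.sum_nonneg fun i _ => mul_nonneg (abs_nonneg _) (apply_nonneg μ _)

theorem weight_add_le (μ : PseudoNorm) (x y : RealSeq) :
    weight μ (x + y) ≤ weight μ x + weight μ y := by
  classical
  rw [weight_eq_sum μ (x + y) (x.support ∪ y.support) Finsupp.support_add,
    weight_eq_sum μ x (x.support ∪ y.support) Finset.subset_union_left,
    weight_eq_sum μ y (x.support ∪ y.support) Finset.subset_union_right,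
    ← Finset.sum_add_distrib]
  refine Finset.sum_le_sum fun i _ => ?_
  rw [← add_mul, Finsupp.add_apply]
  exact mul_le_mul_of_nonneg_right (abs_add_le _ _) (apply_nonneg μ _)

theorem weight_smul (μ : PseudoNorm) (r : ℝ) (x : RealSeq) :
    weight μ (r • x) = |r| * weight μ x := by
  rw [weight_eq_sum μ (r • x) x.support Finsupp.support_smul,
    weight_eq_sum μ x x.support subset_rfl, Finset.mul_sum]
  refine Finset.sum_congr rfl fun i _ => ?_
  rw [Finsupp.smul_apply, smul_eq_mul, abs_mul, mul_assoc]

/-- A seminorm on `V` is dominated by the weighted `ℓ₁`-seminorm. -/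
theorem le_weight (μ : PseudoNorm) (v : RatSeq) : μ v ≤ weight μ (incl v) := by
  rw [weight_eq_sum μ (incl v) v.support (by intro i; simp)]
  conv_lhs => rw [← v.sum_single, Finsupp.sum]
  refine (Finset.le_sum_of_subadditive μ (map_zero μ).le (map_add_le_add μ) _ _).trans (Finset.sum_le_sum fun i _ => ?_)
  have h : Finsupp.single i (v i) = v i • (Finsupp.single i 1 : RatSeq) := by simp
  rw [h, map_smul_eq_mul]
  exact le_rfl

/-- The value at `x ∈ c₀₀` of the extension of the pseudonorm `μ` from `V` to `c₀₀`. -/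
def extFun (μ : PseudoNorm) (x : RealSeq) : ℝ :=
  ⨅ v : RatSeq, (μ v + weight μ (x - incl v))

theorem extFun_le (μ : PseudoNorm) (x : RealSeq) (v : RatSeq) :
    extFun μ x ≤ μ v + weight μ (x - incl v) :=
  ciInf_le ⟨0, by
    rintro _ ⟨w, rfl⟩
    exact add_nonneg (apply_nonneg μ w) (weight_nonneg μ _)⟩ v

theorem extFun_incl (μ : PseudoNorm) (v : RatSeq) : extFun μ (incl v) = μ v := by
  refine le_antisymm ?_ (le_ciInf fun w => ?_)
  · refine (extFun_le μ _ v).trans ?_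
    simp [weight]
  · have h : incl v - incl w = incl (v - w) := by ext i; simp
    rw [h]
    have h1 := map_add_le_add μ w (v - w)
    rw [add_sub_cancel] at h1
    linarith [le_weight μ (v - w)]

theorem extFun_add_le (μ : PseudoNorm) (x y : RealSeq) :
    extFun μ (x + y) ≤ extFun μ x + extFun μ y := by
  refine le_ciInf_add_ciInf fun v w => ?_
  refine (extFun_le μ _ (v + w)).trans ?_
  have h : x + y - incl (v + w) = (x - incl v) + (y - incl w) := by rw [incl_add]; abel
  rw [h]
  linarith [weight_add_le μ (x - incl v) (y - incl w), map_add_le_add μ v w]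

theorem extFun_le_weight (μ : PseudoNorm) (x : RealSeq) : extFun μ x ≤ weight μ x := by
  have h := extFun_le μ x 0
  have h0 : incl 0 = 0 := by ext i; simp
  rwa [h0, sub_zero, map_zero, zero_add] at h

theorem extFun_rat_smul_le (μ : PseudoNorm) (q : ℚ) (x : RealSeq) :
    extFun μ ((q : ℝ) • x) ≤ |(q : ℝ)| * extFun μ x := by
  rw [extFun, extFun, Real.mul_iInf_of_nonneg (abs_nonneg _)]
  refine le_ciInf fun v => (extFun_le μ _ (q • v)).trans (le_of_eq ?_)
  rw [incl_smul, ← smul_sub, weight_smul, map_smul_eq_mul, mul_add]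
  rfl

theorem extFun_smul_le (μ : PseudoNorm) (r : ℝ) (x : RealSeq) :
    extFun μ (r • x) ≤ |r| * extFun μ x := by
  have hx : 0 ≤ extFun μ x :=
    Real.iInf_nonneg fun v => add_nonneg (apply_nonneg μ v) (weight_nonneg μ _)
  have hw := weight_nonneg μ x
  refine le_of_forall_pos_le_add fun ε hε => ?_
  have hd : 0 < ε / (extFun μ x + weight μ x + 1) := by positivity
  obtain ⟨q, hq1, hq2⟩ := exists_rat_btwn (sub_lt_self r hd)
  have hrq : |r - q| ≤ ε / (extFun μ x + weight μ x + 1) := by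
    rw [abs_le]; constructor <;> linarith
  have h1 : r • x = (q : ℝ) • x + (r - q) • x := by rw [← add_smul]; congr 1; ring
  have h2 : extFun μ (r • x) ≤ |(q : ℝ)| * extFun μ x + |r - q| * weight μ x := by
    rw [h1]
    refine (extFun_add_le μ _ _).trans (add_le_add (extFun_rat_smul_le μ q x) ?_)
    exact (extFun_le_weight μ _).trans (weight_smul μ _ _).le
  have h3 : |(q : ℝ)| ≤ |r| + |r - q| := by
    have := abs_sub_abs_le_abs_sub (q : ℝ) r
    rw [abs_sub_comm] at this
    linarith
  have h4 : |r - q| * (extFun μ x + weight μ x + 1) ≤ ε := by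
    rwa [le_div_iff₀ (by positivity)] at hrq
  nlinarith [mul_le_mul_of_nonneg_right h3 hx, abs_nonneg (r - q)]

/-- The extension of the pseudonorm `μ` from `V` to `c₀₀`. By `ext_incl` and `eq_ext` it is the
unique pseudonorm on the real vector space `c₀₀` whose restriction to `V` is `μ`. -/
def ext (μ : PseudoNorm) : Seminorm ℝ RealSeq :=
  Seminorm.ofSMulLE (extFun μ)
    (le_antisymm ((extFun_le_weight μ 0).trans (by simp [weight]))
      (Real.iInf_nonneg fun v => add_nonneg (apply_nonneg μ v) (weight_nonneg μ _)))
    (extFun_add_le μ) (extFun_smul_le μ)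

theorem ext_incl (μ : PseudoNorm) (v : RatSeq) : μ.ext (incl v) = μ v := extFun_incl μ v

theorem exists_weight_sub_lt (μ : PseudoNorm) (x : RealSeq) {ε : ℝ} (hε : 0 < ε) :
    ∃ v : RatSeq, weight μ (x - incl v) < ε := by
  induction x using Finsupp.induction generalizing ε with
  | zero =>
    have h0 : (0 : RealSeq) - incl 0 = 0 := by ext i; simp
    exact ⟨0, by rw [h0]; simpa [weight] using hε⟩
  | single_add i a x _ _ ih =>
    obtain ⟨v, hv⟩ := ih (half_pos hε)
    have hm : 0 ≤ μ (Finsupp.single i 1) := apply_nonneg μ _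
    have hd : 0 < ε / 2 / (μ (Finsupp.single i 1) + 1) := by positivity
    obtain ⟨q, hq1, hq2⟩ := exists_rat_btwn (sub_lt_self a hd)
    refine ⟨Finsupp.single i q + v, ?_⟩
    have h : Finsupp.single i a + x - incl (Finsupp.single i q + v)
        = Finsupp.single i (a - q) + (x - incl v) := by
      have h' : incl (Finsupp.single i q) = Finsupp.single i (q : ℝ) := by
        simp [incl]
      rw [incl_add, h', Finsupp.single_sub]; abel
    rw [h]
    refine (weight_add_le μ _ _).trans_lt ?_
    have h1 : weight μ (Finsupp.single i (a - q)) = |a - q| * μ (Finsupp.single i 1) :=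
      Finsupp.sum_single_index (by simp)
    have h2 : |a - q| ≤ ε / 2 / (μ (Finsupp.single i 1) + 1) := by
      rw [abs_le]; constructor <;> linarith
    rw [le_div_iff₀ (by positivity)] at h2
    nlinarith [abs_nonneg (a - q)]

/-- Uniqueness of the extension. -/
theorem eq_ext (μ : PseudoNorm) (p : Seminorm ℝ RealSeq) (hp : ∀ v, p (incl v) = μ v) :
    p = μ.ext := by
  have hpw : ∀ x, p x ≤ weight μ x := by
    intro x
    conv_lhs => rw [← x.sum_single, Finsupp.sum]
    refine (Finset.le_sum_of_subadditive p (map_zero p).le (map_add_le_add p) _ _).trans (Finset.sum_le_sum fun i _ => ?_)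
    have h : Finsupp.single i (x i) = x i • incl (Finsupp.single i 1) := by simp [incl]
    rw [h, map_smul_eq_mul, hp, Real.norm_eq_abs]
  have key : ∀ p' q' : Seminorm ℝ RealSeq, (∀ v, p' (incl v) = μ v) →
      (∀ v, q' (incl v) = μ v) → (∀ x, p' x ≤ weight μ x) → (∀ x, q' x ≤ weight μ x) →
      ∀ x, p' x ≤ q' x := by
    intro p' q' h1 h2 h3 h4 x
    refine le_of_forall_pos_le_add fun ε hε => ?_
    obtain ⟨v, hv⟩ := exists_weight_sub_lt μ x (half_pos hε)
    have e1 : p' x ≤ p' (incl v) + p' (x - incl v) := by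
      simpa using map_add_le_add p' (incl v) (x - incl v)
    have e2 : q' (incl v) ≤ q' x + q' (x - incl v) := by
      simpa using map_sub_le_add q' x (x - incl v)
    linarith [h1 v, h2 v, h3 (x - incl v), h4 (x - incl v)]
  have hew : ∀ x, μ.ext x ≤ weight μ x := extFun_le_weight μ
  exact Seminorm.ext fun x => le_antisymm (key p μ.ext hp (ext_incl μ) hpw hew x)
    (key μ.ext p (ext_incl μ) hp hew hpw x)

/-! ### The Banach space coded by a pseudonorm -/

/-- The seminormed space `(c₀₀, μ)`. -/
def Carrier (_μ : PseudoNorm) : Type := RealSeq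

instance (μ : PseudoNorm) : AddCommGroup μ.Carrier := inferInstanceAs (AddCommGroup RealSeq)

instance (μ : PseudoNorm) : Module ℝ μ.Carrier := inferInstanceAs (Module ℝ RealSeq)

instance (μ : PseudoNorm) : SeminormedAddCommGroup μ.Carrier :=
  AddGroupSeminorm.toSeminormedAddCommGroup (E := μ.Carrier) μ.ext.toAddGroupSeminorm

instance (μ : PseudoNorm) : NormedSpace ℝ μ.Carrier where
  norm_smul_le r x := (map_smul_eq_mul μ.ext r x).le

theorem norm_carrier (μ : PseudoNorm) (x : RealSeq) : ‖(show μ.Carrier from x)‖ = μ.ext x := rfl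

/-- The Banach space `X_μ`: the completion of the quotient of `(c₀₀, μ)` by the subspace
`{x | μ x = 0}` of null vectors. -/
abbrev Space (μ : PseudoNorm) : Type :=
  UniformSpace.Completion (SeparationQuotient μ.Carrier)

/-- The set `𝓟_∞` of those `μ ∈ 𝓟` for which `X_μ` is infinite-dimensional. -/
def infDim : Set PseudoNorm := {μ | ¬ FiniteDimensional ℝ μ.Space}

/-- The set `𝓑` of those `μ ∈ 𝓟_∞` whose extension to `c₀₀` is a norm. -/
def norms : Set PseudoNorm := {μ | μ ∈ infDim ∧ ∀ x : RealSeq, μ.ext x = 0 → x = 0}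

/-- The isometry class of `Z` in `I ⊆ 𝓟`: all `μ ∈ I` for which there is a surjective linear
isometry between `X_μ` and `Z`. -/
def isometryClass (I : Set PseudoNorm) (Z : Type*) [NormedAddCommGroup Z] [NormedSpace ℝ Z] :
    Set PseudoNorm :=
  {μ | μ ∈ I ∧ Nonempty (μ.Space ≃ₗᵢ[ℝ] Z)}

end PseudoNorm

/-! ### The Gurariĭ space -/

/-- A `K`-isomorphism: a linear map `T` with `K⁻¹ ‖x‖ ≤ ‖T x‖ ≤ K ‖x‖` for all `x`
(not necessarily surjective). -/
def IsKIsomorphism {X Y : Type*} [NormedAddCommGroup X] [NormedSpace ℝ X]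
    [NormedAddCommGroup Y] [NormedSpace ℝ Y] (K : ℝ) (T : X →L[ℝ] Y) : Prop :=
  ∀ x, K⁻¹ * ‖x‖ ≤ ‖T x‖ ∧ ‖T x‖ ≤ K * ‖x‖

/-- `G` is a Gurariĭ space: a separable Banach space such that for every `ε > 0`, every subspace
`A` of `G` and every linear isometric embedding `g` of `A` into a finite-dimensional Banach
space `B` there is a `(1 + ε)`-isomorphism `f : B → G` with `‖f ∘ g - id_A‖ ≤ ε`.
It is enough to let `B` range over `Type`: every finite-dimensional normed space is isometric
to one with underlying set `Fin n → ℝ`. -/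
structure IsGurarii (G : Type*) [NormedAddCommGroup G] [NormedSpace ℝ G] : Prop where
  complete : CompleteSpace G
  separable : TopologicalSpace.SeparableSpace G
  exists_extension : ∀ ε : ℝ, 0 < ε → ∀ A : Submodule ℝ G,
    ∀ (B : Type) [NormedAddCommGroup B] [NormedSpace ℝ B] [FiniteDimensional ℝ B],
    ∀ g : A →ₗᵢ[ℝ] B, ∃ f : B →L[ℝ] G, IsKIsomorphism (1 + ε) f ∧
      ‖f ∘L g.toContinuousLinearMap - A.subtypeL‖ ≤ ε

end

/-!
# The Gurariĭ space is the generic separable Banach space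

The Gurariĭ property is translated into a statement about finite tuples. Two tuples `a`, `b` in
possibly different spaces are `δ`-almost isometric if `|‖∑ yᵢ aᵢ‖ - ‖∑ yᵢ bᵢ‖| ≤ δ ∑ |yᵢ|` for all
real coefficients `y` (`AlmostIsometric`). For a separable Banach space `G`, being Gurariĭ is
equivalent to the following property `AlmostExtension G`: whenever `a₀, …, aₙ₋₁` in `G` are
`δ`-almost isometric to the first `n` unit vectors of some `X_ν`, there are, for all `N` and
`ε > 0`, vectors `bᵢ` in `G` whose first `N` terms are `ε`-almost isometric to the unit vectors of
`X_ν` and which satisfy `‖bᵢ - aᵢ‖ ≤ δ + ε` for `i < n`. Only tuples occur here, so that the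
property is easy to read off the pseudonorm which codes a space.

The tool behind everything is amalgamation (`AlmostIsometric.exists_amalgam`): spaces with
`δ`-almost isometric tuples embed isometrically into a common seminormed space in which these
tuples are `δ`-close. Applying the Gurariĭ property inside an amalgam gives
`IsGurarii.almostExtension`; the converse `AlmostExtension.isGurarii` only needs that coordinates
on a finite-dimensional space are bounded.

*Uniqueness.* Two spaces with the extension property contain sequences `α`, `β` with dense spans
which are limits of tuples that are ever more isometric to each other, built by going back and
forth (`AlmostExtension.exists_step`); hence `α` and `β` are isometric and so are the spaces.

*Genericity.* Letting `ν` range over a countable dense set of pseudonorms and `a` over tuples in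
`V`, the extension property of `X_μ` becomes a countable family of conditions on `μ`
(`almostExtension_iff`). Each is open, because pointwise close pseudonorms are uniformly close on
finite-dimensional subspaces (`eventually_almostIsometric`). Each is dense, because for large `K` a
given `μ₀` may be changed beyond the first `K` coordinates in such a way that `X_ν` appears there,
amalgamated with `X_μ₀` (`dense_extensionSet`). Together with the dense open conditions of being a
norm on the first `n` coordinates, Baire's theorem in the Polish space `𝓟` shows that norms with
the extension property are dense in `𝓟`. As they lie in `𝓑 ⊆ 𝓟_∞ ⊆ 𝓟`, this gives density in all
three spaces, and the existence of a Gurariĭ space.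
-/

noncomputable section

open Finset Filter Topology

/-! ### Almost isometric tuples -/

section AlmostIsometric

variable {E F H : Type*} [NormedAddCommGroup E] [NormedSpace ℝ E]
  [NormedAddCommGroup F] [NormedSpace ℝ F] [NormedAddCommGroup H] [NormedSpace ℝ H]

/-- The first `n` terms of the sequences `a` and `b`, which may lie in different spaces, are
`δ`-almost isometric: the norms of corresponding linear combinations differ by at most `δ` times
the `ℓ₁`-norm of the coefficients. Terms of index `≥ n` play no role. -/
def AlmostIsometric (n : ℕ) (δ : ℝ) (a : ℕ → E) (b : ℕ → F) : Prop :=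
  ∀ y : ℕ → ℝ, |‖∑ i ∈ range n, y i • a i‖ - ‖∑ i ∈ range n, y i • b i‖|
    ≤ δ * ∑ i ∈ range n, |y i|

/-- Coefficients of index `≥ m` may be set to zero in order to shorten a sum. -/
theorem sum_range_truncate {X : Type*} [AddCommMonoid X] {m n : ℕ} (hm : m ≤ n)
    (f : ℕ → ℝ → X) (hf : ∀ i, f i 0 = 0) (y : ℕ → ℝ) :
    ∑ i ∈ range n, f i (if i < m then y i else 0) = ∑ i ∈ range m, f i (y i) := by
  rw [← sum_subset (range_subset_range.2 hm)]
  · exact sum_congr rfl fun i hi => by rw [if_pos (mem_range.1 hi)]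
  · intro i _ hi
    rw [if_neg (by simpa using hi), hf]

namespace AlmostIsometric

variable {n : ℕ} {δ ε : ℝ} {a a' : ℕ → E} {b : ℕ → F} {c : ℕ → H}

theorem symm (h : AlmostIsometric n δ a b) : AlmostIsometric n δ b a := fun y => by
  rw [abs_sub_comm]; exact h y

theorem trans (h : AlmostIsometric n δ a b) (h' : AlmostIsometric n ε b c) :
    AlmostIsometric n (δ + ε) a c := fun y => by
  rw [add_mul]
  exact (abs_sub_le _ _ _).trans (add_le_add (h y) (h' y))

theorem mono_right (h : AlmostIsometric n δ a b) (hδ : δ ≤ ε) : AlmostIsometric n ε a b :=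
  fun y => (h y).trans (mul_le_mul_of_nonneg_right hδ (sum_nonneg fun _ _ => abs_nonneg _))

theorem mono_left {m : ℕ} (h : AlmostIsometric n δ a b) (hm : m ≤ n) :
    AlmostIsometric m δ a b := fun y => by
  have := h fun i => if i < m then y i else 0
  rwa [sum_range_truncate hm (fun i r => r • a i) (by simp),
    sum_range_truncate hm (fun i r => r • b i) (by simp),
    sum_range_truncate hm (fun _ r => |r|) (by simp)] at this

theorem of_norm_eq
    (h : ∀ y : ℕ → ℝ, ‖∑ i ∈ range n, y i • a i‖ = ‖∑ i ∈ range n, y i • b i‖) :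
    AlmostIsometric n 0 a b := fun y => by rw [h y]; simp

theorem norm_eq (h : AlmostIsometric n 0 a b) (y : ℕ → ℝ) :
    ‖∑ i ∈ range n, y i • a i‖ = ‖∑ i ∈ range n, y i • b i‖ := by
  have := h y
  rw [zero_mul] at this
  exact sub_eq_zero.1 (abs_nonpos_iff.1 this)

theorem of_norm_sub_le (h : ∀ i < n, ‖a i - a' i‖ ≤ δ) : AlmostIsometric n δ a a' := fun y => by
  refine (abs_norm_sub_norm_le _ _).trans ?_
  rw [← sum_sub_distrib, mul_sum]
  refine norm_sum_le_of_le _ fun i hi => ?_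
  rw [← smul_sub, norm_smul, Real.norm_eq_abs, mul_comm]
  exact mul_le_mul_of_nonneg_right (h i (mem_range.1 hi)) (abs_nonneg _)

theorem congr_left (h : AlmostIsometric n δ a b) (h' : ∀ i < n, a' i = a i) :
    AlmostIsometric n δ a' b := fun y => by
  rw [sum_congr rfl fun i hi => by rw [h' i (mem_range.1 hi)]]
  exact h y

theorem congr_right {b' : ℕ → F} (h : AlmostIsometric n δ a b) (h' : ∀ i < n, b' i = b i) :
    AlmostIsometric n δ a b' :=
  (h.symm.congr_left h').symm

theorem comp_isometry (e : E →ₗᵢ[ℝ] H) (a : ℕ → E) (n : ℕ) :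
    AlmostIsometric n 0 (fun i => e (a i)) a := of_norm_eq fun y => by
  rw [← e.norm_map (∑ i ∈ range n, y i • a i), map_sum]
  simp only [map_smul]

end AlmostIsometric

end AlmostIsometric

/-! ### Pseudonorms and tuples -/

namespace PseudoNorm

/-- The canonical linear map `c₀₀ → X_μ`. -/
def toSpace (μ : PseudoNorm) : RealSeq →ₗ[ℝ] μ.Space :=
  (UniformSpace.Completion.toComplₗᵢ (𝕜 := ℝ)
      (E := SeparationQuotient μ.Carrier)).toLinearMap ∘ₗ
    (SeparationQuotient.mkCLM ℝ μ.Carrier).toLinearMap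

theorem norm_toSpace (μ : PseudoNorm) (x : RealSeq) : ‖μ.toSpace x‖ = μ.ext x :=
  (UniformSpace.Completion.norm_coe _).trans (SeparationQuotient.norm_mk (E := μ.Carrier) x)

theorem denseRange_toSpace (μ : PseudoNorm) : DenseRange μ.toSpace :=
  UniformSpace.Completion.denseRange_coe.comp
    (SeparationQuotient.surjective_mk (X := μ.Carrier)).denseRange
    (UniformSpace.Completion.continuous_coe _)

/-- The image in `X_μ` of the `i`-th unit vector. -/
def unitVec (μ : PseudoNorm) (i : ℕ) : μ.Space := μ.toSpace (Finsupp.single i 1)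

theorem sum_smul_toSpace (μ : PseudoNorm) (w : ℕ → RealSeq) (n : ℕ) (y : ℕ → ℝ) :
    ∑ i ∈ range n, y i • μ.toSpace (w i) = μ.toSpace (∑ i ∈ range n, y i • w i) := by
  simp

theorem exists_toSpace_incl_lt (μ : PseudoNorm) (u : μ.Space) {ε : ℝ} (hε : 0 < ε) :
    ∃ v : RatSeq, ‖μ.toSpace (incl v) - u‖ < ε := by
  obtain ⟨x, hx⟩ := μ.denseRange_toSpace.exists_dist_lt u (half_pos hε)
  obtain ⟨v, hv⟩ := exists_weight_sub_lt μ x (half_pos hε)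
  refine ⟨v, ?_⟩
  have h1 : ‖μ.toSpace (x - incl v)‖ ≤ weight μ (x - incl v) := by
    rw [norm_toSpace]; exact extFun_le_weight μ _
  rw [map_sub] at h1
  rw [dist_eq_norm] at hx
  have := norm_sub_le_norm_sub_add_norm_sub (μ.toSpace (incl v)) (μ.toSpace x) u
  rw [norm_sub_rev] at h1
  rw [norm_sub_rev u] at hx
  linarith

instance separableSpace_space (μ : PseudoNorm) : TopologicalSpace.SeparableSpace μ.Space := by
  have hd : DenseRange fun v : RatSeq => μ.toSpace (incl v) := by
    refine Metric.denseRange_iff.2 fun u ε hε => ?_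
    obtain ⟨v, hv⟩ := μ.exists_toSpace_incl_lt u hε
    exact ⟨v, by rwa [dist_comm, dist_eq_norm]⟩
  exact ⟨_, Set.countable_range _, hd⟩

/-- The restriction to `V` of a pseudonorm on `c₀₀`. -/
def restrict (p : Seminorm ℝ RealSeq) : PseudoNorm :=
  Seminorm.of (fun v => p (incl v)) (fun v w => by rw [incl_add]; exact map_add_le_add p _ _)
    fun q v => by rw [incl_smul, map_smul_eq_mul]; rfl

@[simp] theorem ext_restrict (p : Seminorm ℝ RealSeq) : (restrict p).ext = p :=
  (eq_ext _ p fun _ => rfl).symm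

/-- The pseudonorm which makes the unit vectors of `c₀₀` isometric to the sequence `t` of
vectors of a seminormed space. -/
def ofTuple {W : Type*} [AddCommGroup W] [Module ℝ W] (p : Seminorm ℝ W) (t : ℕ → W) :
    PseudoNorm :=
  restrict (p.comp (Finsupp.linearCombination ℝ t))

theorem norm_sum_unitVec_ofTuple {W : Type*} [AddCommGroup W] [Module ℝ W] (p : Seminorm ℝ W)
    (t : ℕ → W) (s : Finset ℕ) (y : ℕ → ℝ) :
    ‖∑ i ∈ s, y i • (ofTuple p t).unitVec i‖ = p (∑ i ∈ s, y i • t i) := by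
  have : ∑ i ∈ s, y i • (ofTuple p t).unitVec i
      = (ofTuple p t).toSpace (∑ i ∈ s, y i • Finsupp.single i 1) := by
    simp only [unitVec, map_sum, map_smul]
  rw [this, norm_toSpace, ofTuple, ext_restrict, Seminorm.comp_apply, map_sum]
  simp

theorem almostIsometric_ofTuple {E : Type*} [NormedAddCommGroup E] [NormedSpace ℝ E]
    (t : ℕ → E) (n : ℕ) :
    AlmostIsometric n 0 (ofTuple (normSeminorm ℝ E) t).unitVec t :=
  .of_norm_eq fun _ => norm_sum_unitVec_ofTuple _ _ _ _

end PseudoNorm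

/-! ### Amalgamation -/

section Amalgam

variable {E Z : Type*} [AddCommGroup E] [Module ℝ E] [AddCommGroup Z] [Module ℝ Z]

/-- The quotient-type seminorm `x ↦ inf_z S (x, z)`. -/
def Seminorm.infSnd (S : Seminorm ℝ (E × Z)) : Seminorm ℝ E :=
  Seminorm.ofSMulLE (fun x => ⨅ z : Z, S (x, z))
    (le_antisymm (ciInf_le_of_le ⟨0, by rintro _ ⟨z, rfl⟩; exact apply_nonneg S _⟩ 0
      (map_zero S).le) (Real.iInf_nonneg fun z => apply_nonneg S _))
    (fun x y => le_ciInf_add_ciInf fun z w =>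
      ciInf_le_of_le ⟨0, by rintro _ ⟨z, rfl⟩; exact apply_nonneg S _⟩ (z + w)
        (map_add_le_add S (x, z) (y, w)))
    fun r x => by
      rw [Real.mul_iInf_of_nonneg (norm_nonneg r)]
      exact le_ciInf fun z =>
        ciInf_le_of_le ⟨0, by rintro _ ⟨z, rfl⟩; exact apply_nonneg S _⟩ (r • z)
          (map_smul_eq_mul S r (x, z)).le

theorem Seminorm.infSnd_le (S : Seminorm ℝ (E × Z)) (x : E)
    (z : Z) : S.infSnd x ≤ S (x, z) :=
  ciInf_le ⟨0, by rintro _ ⟨z, rfl⟩; exact apply_nonneg S _⟩ z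

theorem Seminorm.le_infSnd {S : Seminorm ℝ (E × Z)} {x : E}
    {r : ℝ} (h : ∀ z, r ≤ S (x, z)) : r ≤ S.infSnd x :=
  le_ciInf h

/-- Two normed spaces with almost isometric tuples `a` and `b` embed isometrically into a common
seminormed space in such a way that corresponding vectors become `δ`-close. The seminorm is
`(u, v) ↦ inf_z ‖u - ∑ zᵢ aᵢ‖ + ‖v + ∑ zᵢ bᵢ‖ + δ ∑ |zᵢ|`. -/
theorem AlmostIsometric.exists_amalgam {E F : Type*} [NormedAddCommGroup E] [NormedSpace ℝ E]
    [NormedAddCommGroup F] [NormedSpace ℝ F] {n : ℕ} {δ : ℝ} (hδ : 0 ≤ δ) {a : ℕ → E} {b : ℕ → F}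
    (h : AlmostIsometric n δ a b) :
    ∃ p : Seminorm ℝ (E × F), (∀ u, p (u, 0) = ‖u‖) ∧ (∀ v, p (0, v) = ‖v‖) ∧
      ∀ i < n, p (a i, - b i) ≤ δ := by
  let S : Seminorm ℝ ((E × F) × (ℕ → ℝ)) := Seminorm.of
    (fun x => ‖x.1.1 - ∑ i ∈ range n, x.2 i • a i‖ + ‖x.1.2 + ∑ i ∈ range n, x.2 i • b i‖
      + δ * ∑ i ∈ range n, |x.2 i|)
    (by
      rintro ⟨⟨u, v⟩, z⟩ ⟨⟨u', v'⟩, z'⟩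
      have h1 := norm_add_le (u - ∑ i ∈ range n, z i • a i) (u' - ∑ i ∈ range n, z' i • a i)
      have h2 := norm_add_le (v + ∑ i ∈ range n, z i • b i) (v' + ∑ i ∈ range n, z' i • b i)
      have h3 : δ * ∑ i ∈ range n, |z i + z' i|
          ≤ δ * ∑ i ∈ range n, |z i| + δ * ∑ i ∈ range n, |z' i| := by
        rw [← mul_add, ← sum_add_distrib]
        exact mul_le_mul_of_nonneg_left (sum_le_sum fun i _ => abs_add_le _ _) hδ
      rw [sub_add_sub_comm] at h1
      rw [add_add_add_comm] at h2
      simp only [Prod.mk_add_mk, Pi.add_apply, add_smul, sum_add_distrib] at *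
      linarith)
    (by
      rintro r ⟨⟨u, v⟩, z⟩
      simp only [Prod.smul_mk, Pi.smul_apply, smul_eq_mul, mul_smul, ← smul_sum, ← smul_sub,
        ← smul_add, norm_smul, abs_mul, ← mul_sum, Real.norm_eq_abs]
      ring)
  have hS : ∀ u v z, S ((u, v), z) = ‖u - ∑ i ∈ range n, z i • a i‖
    + ‖v + ∑ i ∈ range n, z i • b i‖ + δ * ∑ i ∈ range n, |z i| := fun _ _ _ => rfl
  refine ⟨S.infSnd, fun u => le_antisymm ?_ (Seminorm.le_infSnd fun z => ?_),
    fun v => le_antisymm ?_ (Seminorm.le_infSnd fun z => ?_), fun i hi => ?_⟩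
  · refine (S.infSnd_le _ 0).trans ?_
    simp [hS]
  · rw [hS, zero_add]
    have h1 := norm_sub_norm_le u (∑ i ∈ range n, z i • a i)
    have h2 := (abs_le.1 (h z)).2
    linarith
  · refine (S.infSnd_le _ 0).trans ?_
    simp [hS]
  · rw [hS, zero_sub, norm_neg]
    have h1 := norm_sub_norm_le v (-∑ i ∈ range n, z i • b i)
    rw [norm_neg, sub_neg_eq_add] at h1
    have h2 := (abs_le.1 (h z)).1
    linarith
  · refine (S.infSnd_le _ (Pi.single i 1)).trans ?_
    simp [hS, Pi.single_apply, apply_ite abs, hi]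

end Amalgam

/-! ### The Gurariĭ property in terms of tuples -/

/-- The tuple form of the Gurariĭ property: if finitely many vectors `aᵢ` of `G` are `δ`-almost
isometric to the first unit vectors of some `X_ν`, then the first `N` unit vectors of `X_ν` are
`ε`-almost isometric, for any `ε > 0`, to vectors `bᵢ` of `G` with `bᵢ` almost `δ`-close
to `aᵢ`. -/
def AlmostExtension (G : Type*) [NormedAddCommGroup G] [NormedSpace ℝ G] : Prop :=
  ∀ (ν : PseudoNorm) (a : ℕ → G) (n N : ℕ) (δ ε : ℝ), 0 ≤ δ → 0 < ε →
    AlmostIsometric n δ a ν.unitVec →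
    ∃ b : ℕ → G, AlmostIsometric N ε b ν.unitVec ∧ ∀ i < n, ‖b i - a i‖ ≤ δ + ε

section

variable {G : Type*} [NormedAddCommGroup G] [NormedSpace ℝ G]

/-- The target tuple in the extension property may live in any normed space. -/
theorem AlmostExtension.exists_tuple (hG : AlmostExtension G) {F : Type*} [NormedAddCommGroup F]
    [NormedSpace ℝ F] {a : ℕ → G} {t : ℕ → F} {n : ℕ} {δ : ℝ} (hδ : 0 ≤ δ)
    (h : AlmostIsometric n δ a t) (N : ℕ) {ε : ℝ} (hε : 0 < ε) :
    ∃ b : ℕ → G, AlmostIsometric N ε b t ∧ ∀ i < n, ‖b i - a i‖ ≤ δ + ε := by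
  have ht := PseudoNorm.almostIsometric_ofTuple t
  obtain ⟨b, hb, hb'⟩ := hG _ a n N δ ε hδ hε ((h.trans (ht n).symm).mono_right (by simp))
  exact ⟨b, (hb.trans (ht N)).mono_right (by simp), hb'⟩

theorem AlmostExtension.of_equiv {X : Type*} [NormedAddCommGroup X] [NormedSpace ℝ X]
    (e : X ≃ₗᵢ[ℝ] G) (hG : AlmostExtension G) : AlmostExtension X := by
  intro ν a n N δ ε hδ hε h
  obtain ⟨b, hb, hb'⟩ := hG ν (fun i => e (a i)) n N δ ε hδ hε
    (((AlmostIsometric.comp_isometry e.toLinearIsometry a n).trans h).mono_right (by simp))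
  refine ⟨fun i => e.symm (b i), ((AlmostIsometric.comp_isometry e.symm.toLinearIsometry b N).trans
    hb).mono_right (by simp), fun i hi => ?_⟩
  rw [← e.norm_map, map_sub, e.apply_symm_apply]
  exact hb' i hi

/-- Two linear maps on a common domain with equal norms induce an isometry defined on the range
of one of them. -/
theorem exists_linearIsometry_range {E F : Type*} [AddCommGroup E] [Module ℝ E]
    [NormedAddCommGroup F] [NormedSpace ℝ F] (L : E →ₗ[ℝ] G) (M : E →ₗ[ℝ] F)
    (h : ∀ x, ‖M x‖ = ‖L x‖) :
    ∃ g : LinearMap.range L →ₗᵢ[ℝ] F, ∀ x, g ⟨L x, x, rfl⟩ = M x := by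
  have hg : ∀ x, M.compLeftInverse L ⟨L x, x, rfl⟩ = M x := fun x =>
    LinearMap.compLeftInverse_apply_of_bdd _ _ ⟨1, fun x => by rw [one_mul, h x]⟩ x _ rfl
  refine ⟨⟨(M.compLeftInverse L).toLinearMap, ?_⟩, hg⟩
  rintro ⟨_, x, rfl⟩
  exact (congrArg norm (hg x)).trans (h x)

theorem IsKIsomorphism.abs_norm_sub_le {X Y : Type*} [NormedAddCommGroup X] [NormedSpace ℝ X]
    [NormedAddCommGroup Y] [NormedSpace ℝ Y] {ε : ℝ} (hε : 0 < ε) {f : X →L[ℝ] Y}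
    (hf : IsKIsomorphism (1 + ε) f) (x : X) : |‖f x‖ - ‖x‖| ≤ ε * ‖x‖ := by
  have h1 : 1 - ε ≤ (1 + ε)⁻¹ := by
    rw [← one_div, le_div_iff₀ (by linarith)]; nlinarith
  rw [abs_le]
  constructor
  · nlinarith [(hf x).1, mul_le_mul_of_nonneg_right h1 (norm_nonneg x)]
  · linarith [(hf x).2]

/-- A Gurariĭ space has the tuple extension property: apply the Gurariĭ property to the span of
the `aᵢ` inside the amalgam of `G` with `X_ν`. -/
theorem IsGurarii.almostExtension (hG : IsGurarii G) : AlmostExtension G := by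
  intro ν a n N δ ε hδ hε h
  obtain ⟨p, hp1, hp2, hp3⟩ := h.exists_amalgam hδ
  -- the `aᵢ`, followed by the unit vectors of `X_ν`, in the amalgam `(G × X_ν, p)`; they are copied
  -- to a normed space `X : Type`, because `G` may lie in a higher universe
  let t : ℕ → G × ν.Space := fun i => if i < n then (a i, 0) else (0, ν.unitVec (i - n))
  have ht1 : ∀ i < n, t i = (a i, 0) := fun i hi => if_pos hi
  have ht2 : ∀ i, t (n + i) = (0, ν.unitVec i) := fun i => by simp [t]
  obtain ⟨X, _, _, s, hs⟩ : ∃ (X : Type) (_ : NormedAddCommGroup X) (_ : NormedSpace ℝ X)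
      (s : ℕ → X), ∀ r (y : ℕ → ℝ), ‖∑ i ∈ r, y i • s i‖ = p (∑ i ∈ r, y i • t i) :=
    ⟨_, _, _, _, PseudoNorm.norm_sum_unitVec_ofTuple p t⟩
  let M := max n N
  let B := Submodule.span ℝ (s '' Set.Iio (n + M))
  have : FiniteDimensional ℝ B := FiniteDimensional.span_of_finite ℝ ((Set.finite_Iio _).image _)
  let u : ℕ → B := fun i =>
    if hi : i < n + M then ⟨s i, Submodule.subset_span ⟨i, hi, rfl⟩⟩ else 0
  have hu : ∀ i < n + M, (u i : X) = s i := fun i hi => by simp [u, hi]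
  have hnM : n ≤ M := le_max_left _ _
  have hNM : N ≤ M := le_max_right _ _
  have hgdef := exists_linearIsometry_range
    (Fintype.linearCombination ℝ fun i : Fin n => a i)
    (Fintype.linearCombination ℝ fun i : Fin n => u i) fun x => by
      let y : ℕ → ℝ := fun i => if hi : i < n then x ⟨i, hi⟩ else 0
      have hy : ∀ i : Fin n, x i = y i := fun i => by simp [y]
      simp only [Fintype.linearCombination_apply, hy]
      rw [Submodule.coe_norm, Submodule.coe_sum]
      rw [Fin.sum_univ_eq_sum_range (fun i => ((y i • u i : B) : X)),
        Fin.sum_univ_eq_sum_range (fun i => y i • a i)]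
      rw [sum_congr rfl fun i hi => show ((y i • u i : B) : X) = y i • s i by
        rw [Submodule.coe_smul, hu i (by have := mem_range.1 hi; omega)], hs,
        sum_congr rfl fun i hi => by rw [ht1 i (mem_range.1 hi)]]
      rw [← hp1]
      congr 1
      ext <;> simp [Prod.fst_sum, Prod.snd_sum]
  obtain ⟨g, hg⟩ := hgdef
  let C := ∑ i ∈ range N, ‖ν.unitVec i‖
  let D := ∑ i ∈ range n, ‖a i‖
  have hC : 0 ≤ C := sum_nonneg fun _ _ => norm_nonneg _
  have hD : 0 ≤ D := sum_nonneg fun _ _ => norm_nonneg _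
  -- this `θ` satisfies `θ * C ≤ ε` and `θ * (δ + ‖a i‖) ≤ ε`
  let θ := (ε) / (C + D + δ + 1)
  have hθ : 0 < θ := div_pos hε (by linarith)
  have hθ' : θ * (C + D + δ + 1) = ε := div_mul_cancel₀ _ (by linarith)
  obtain ⟨f, hf, hfg⟩ := hG.exists_extension θ hθ _ B g
  have hga : ∀ i (hi : i < n), ∃ m, g ⟨a i, m⟩ = u i := fun i hi => by
    have := hg (Pi.single ⟨i, hi⟩ 1)
    simp only [Fintype.linearCombination_apply_single, one_smul] at this
    exact ⟨_, this⟩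
  refine ⟨fun i => f (u (n + i)), fun y => ?_, fun i hi => ?_⟩
  · have h1 : ∑ i ∈ range N, y i • f (u (n + i)) = f (∑ i ∈ range N, y i • u (n + i)) := by
      simp only [map_sum, map_smul]
    have h2 : ‖∑ i ∈ range N, y i • u (n + i)‖ = ‖∑ i ∈ range N, y i • ν.unitVec i‖ := by
      have h3 := hs ((range N).map (addLeftEmbedding n)) fun i => y (i - n)
      simp only [sum_map, addLeftEmbedding_apply, Nat.add_sub_cancel_left, ht2] at h3
      rw [Submodule.coe_norm, Submodule.coe_sum,
        sum_congr rfl fun i hi => show ((y i • u (n + i) : B) : X) = y i • s (n + i) by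
          rw [Submodule.coe_smul, hu _ (by have := mem_range.1 hi; omega)], h3]
      rw [← hp2]
      congr 1
      ext <;> simp [Prod.fst_sum, Prod.snd_sum]
    rw [h1, ← h2]
    refine (hf.abs_norm_sub_le hθ _).trans ?_
    have h3 : ‖∑ i ∈ range N, y i • ν.unitVec i‖ ≤ C * ∑ i ∈ range N, |y i| := by
      rw [mul_sum]
      refine norm_sum_le_of_le _ fun i hi => ?_
      rw [norm_smul, mul_comm, Real.norm_eq_abs]
      exact mul_le_mul_of_nonneg_right (single_le_sum (f := fun i => ‖ν.unitVec i‖)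
        (fun _ _ => norm_nonneg _) hi) (abs_nonneg _)
    rw [h2]
    refine (mul_le_mul_of_nonneg_left h3 hθ.le).trans ?_
    rw [← mul_assoc]
    refine mul_le_mul_of_nonneg_right ?_ (sum_nonneg fun _ _ => abs_nonneg _)
    nlinarith [mul_nonneg hθ.le hD, mul_nonneg hθ.le hδ]
  · obtain ⟨m, hm⟩ := hga i hi
    have h1 : ‖f (u i) - a i‖ ≤ θ * ‖a i‖ := by
      have := (f ∘L g.toContinuousLinearMap - (LinearMap.range _).subtypeL).le_of_opNorm_le hfg
        ⟨a i, m⟩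
      simpa [hm] using this
    have h2 : ‖u (n + i) - u i‖ ≤ δ := by
      rw [norm_sub_rev, Submodule.coe_norm, Submodule.coe_sub, hu _ (by omega), hu _ (by omega)]
      have := hs {i, n + i} fun j => if j = i then 1 else -1
      rw [sum_pair (by omega), sum_pair (by omega)] at this
      simp only [if_true, if_neg (show n + i ≠ i by omega), ht1 i hi, ht2, one_smul, neg_one_smul,
        ← sub_eq_add_neg] at this
      rw [this]
      simpa using hp3 i hi
    have h3 : ‖f (u (n + i)) - f (u i)‖ ≤ (1 + θ) * δ := by
      rw [← map_sub]
      exact (hf _).2.trans (mul_le_mul_of_nonneg_left h2 (by linarith))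
    have h4 : ‖a i‖ ≤ D := single_le_sum (f := fun i => ‖a i‖)
        (fun _ _ => norm_nonneg _) (mem_range.2 hi)
    have h5 := norm_sub_le_norm_sub_add_norm_sub (f (u (n + i))) (f (u i)) (a i)
    nlinarith [mul_nonneg hθ.le hC, mul_le_mul_of_nonneg_left h4 hθ.le]

theorem exists_sum_abs_coord_le {B : Type*} [NormedAddCommGroup B] [NormedSpace ℝ B]
    [FiniteDimensional ℝ B] {m : ℕ} (c : Module.Basis (Fin m) ℝ B) :
    ∃ C : ℝ, 0 ≤ C ∧ ∀ v, ∑ j, |c.repr v j| ≤ C * ‖v‖ := by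
  refine ⟨∑ j, ‖(c.coord j).toContinuousLinearMap‖, sum_nonneg fun _ _ => norm_nonneg _,
    fun v => ?_⟩
  rw [sum_mul]
  exact sum_le_sum fun j _ => (c.coord j).toContinuousLinearMap.le_opNorm v

/-- To extend `g : A → B`, apply the tuple extension property to a basis of `A` and the tuple
consisting of its image under `g` and of a basis of `B`. -/
theorem AlmostExtension.isGurarii [CompleteSpace G] [TopologicalSpace.SeparableSpace G]
    (hG : AlmostExtension G) : IsGurarii G := by
  refine ⟨inferInstance, inferInstance, fun ε hε A B _ _ _ g => ?_⟩
  have : FiniteDimensional ℝ A := .of_injective g.toLinearMap g.injective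
  let p := Module.finrank ℝ A
  let m := Module.finrank ℝ B
  let α : Module.Basis (Fin p) ℝ A := Module.finBasis ℝ A
  let c : Module.Basis (Fin m) ℝ B := Module.finBasis ℝ B
  obtain ⟨CA, hCA, hα⟩ := exists_sum_abs_coord_le α
  obtain ⟨CB, hCB, hc⟩ := exists_sum_abs_coord_le c
  let a : ℕ → G := fun i => if hi : i < p then α ⟨i, hi⟩ else 0
  let t : ℕ → B := fun i => if hi : i < p then g (α ⟨i, hi⟩) else
    if hj : i - p < m then c ⟨i - p, hj⟩ else 0
  have ha : ∀ i : Fin p, a i = α i := fun i => by simp [a]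
  have ht : ∀ i : Fin p, t i = g (α i) := fun i => by simp [t]
  have ht' : ∀ j : Fin m, t (p + j) = c j := fun j => by simp [t]
  have h0 : AlmostIsometric p 0 a t := .of_norm_eq fun y => by
    rw [← Fin.sum_univ_eq_sum_range (fun i => y i • a i),
      ← Fin.sum_univ_eq_sum_range (fun i => y i • t i)]
    simp only [ha, ht]
    simp only [← map_smul, ← map_sum, g.norm_map]
    rw [Submodule.coe_norm]
    simp
  -- this `η` satisfies `η * (2 * CA + CB) ≤ ε` and `η * CB ≤ 1 - (1 + ε)⁻¹`
  let η := ε / (1 + ε) / (2 * CA + CB + 1)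
  have hη : 0 < η := by positivity
  have hη' : η * (2 * CA + CB + 1) = ε / (1 + ε) := div_mul_cancel₀ _ (by positivity)
  have hε1 : ε / (1 + ε) = 1 - (1 + ε)⁻¹ := by field_simp; ring
  have hε2 : ε / (1 + ε) ≤ ε := div_le_self hε.le (by linarith)
  obtain ⟨b, hb, hba⟩ := hG.exists_tuple le_rfl h0 (p + m) hη
  rw [zero_add] at hba
  -- the estimate for `b`, with coefficients split along the two parts of the tuple
  have key : ∀ (y : Fin p → ℝ) (z : Fin m → ℝ),
      |‖∑ i, y i • b i + ∑ j, z j • b (p + j)‖ - ‖∑ i, y i • g (α i) + ∑ j, z j • c j‖|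
        ≤ η * (∑ i, |y i| + ∑ j, |z j|) := by
    intro y z
    let w : ℕ → ℝ := fun i => if hi : i < p then y ⟨i, hi⟩ else
      if hj : i - p < m then z ⟨i - p, hj⟩ else 0
    have hw : ∀ i : Fin p, w i = y i := fun i => by simp [w]
    have hw' : ∀ j : Fin m, w (p + j) = z j := fun j => by simp [w]
    have := hb w
    simp only [sum_range_add] at this
    simpa only [sum_range, hw, hw', ht, ht'] using this
  let f : B →ₗ[ℝ] G := c.constr ℝ fun j => b (p + j)
  have hfv : ∀ v, f v = ∑ j, c.repr v j • b (p + j) := fun v => c.constr_apply_fintype ℝ _ v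
  have hfB : ∀ v, |‖f v‖ - ‖v‖| ≤ ε / (1 + ε) * ‖v‖ := fun v => by
    have := key 0 (c.repr v)
    simp only [Pi.zero_apply, zero_smul, sum_const_zero, zero_add, c.sum_repr, abs_zero,
      ← hfv] at this
    refine this.trans ?_
    rw [← hη']
    nlinarith [mul_le_mul_of_nonneg_left (hc v) hη.le, mul_nonneg hη.le (norm_nonneg v),
      mul_nonneg (mul_nonneg hη.le hCA) (norm_nonneg v)]
  refine ⟨f.toContinuousLinearMap, fun v => ?_, ContinuousLinearMap.opNorm_le_bound _ hε.le
    fun x => ?_⟩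
  · have := abs_le.1 (hfB v)
    change _ ≤ ‖f v‖ ∧ ‖f v‖ ≤ _
    constructor
    · rw [hε1] at this
      linarith
    · nlinarith [norm_nonneg v]
  · change ‖f (g x) - x‖ ≤ ε * ‖x‖
    have h1 : ‖∑ i, α.repr x i • b i - f (g x)‖ ≤ η * (CA + CB) * ‖x‖ := by
      have := key (α.repr x) fun j => - c.repr (g x) j
      simp only [neg_smul, sum_neg_distrib, c.sum_repr, ← hfv, abs_neg, ← map_smul, ← map_sum,
        α.sum_repr, add_neg_cancel, norm_zero, sub_zero, abs_norm] at this
      rw [← sub_eq_add_neg] at this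
      refine this.trans ?_
      rw [mul_assoc]
      refine mul_le_mul_of_nonneg_left ?_ hη.le
      have := hc (g x)
      rw [g.norm_map] at this
      linarith [hα x]
    have h2 : ‖∑ i, α.repr x i • b i - (x : G)‖ ≤ η * CA * ‖x‖ := by
      have hx : (x : G) = ∑ i, α.repr x i • a i := by
        simp only [ha, ← Submodule.coe_smul, ← Submodule.coe_sum, α.sum_repr]
      rw [hx, ← sum_sub_distrib, mul_assoc]
      refine le_trans ?_ (mul_le_mul_of_nonneg_left (hα x) hη.le)
      rw [mul_sum]
      refine norm_sum_le_of_le _ fun i _ => ?_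
      rw [← smul_sub, norm_smul, mul_comm, Real.norm_eq_abs]
      exact mul_le_mul_of_nonneg_right (hba i i.2) (abs_nonneg _)
    have h3 := norm_sub_le_norm_sub_add_norm_sub (f (g x)) (∑ i, α.repr x i • b i) (x : G)
    rw [norm_sub_rev (f (g x)) (∑ i, _)] at h3
    nlinarith [norm_nonneg x, mul_nonneg hη.le (norm_nonneg x),
      mul_le_mul_of_nonneg_right (hη'.le.trans hε2) (norm_nonneg x)]

end

/-! ### Uniqueness -/

/-- Limits of sequences whose increments decay geometrically from the index `k₀` on. -/
theorem exists_limit_of_norm_sub_le {E : Type*} [NormedAddCommGroup E] [CompleteSpace E]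
    {u : ℕ → E} {k₀ : ℕ} {C : ℝ} (h : ∀ k ≥ k₀, ‖u (k + 1) - u k‖ ≤ C * (1 / 2) ^ k) :
    ∃ l, Tendsto u atTop (𝓝 l) ∧ ∀ k ≥ k₀, ‖u k - l‖ ≤ 2 * C * (1 / 2) ^ k := by
  have hstep : ∀ k ≥ k₀, ∀ m, dist (u (m + k)) (u (m + 1 + k)) ≤ C * (1 / 2) ^ k * (1 / 2) ^ m :=
    fun k hk m => by
      rw [dist_comm, dist_eq_norm, add_right_comm, mul_assoc, ← pow_add, add_comm k]
      exact h _ (by omega)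
  obtain ⟨l, hl⟩ := cauchySeq_tendsto_of_complete
    (cauchySeq_of_le_geometric (1 / 2) _ (by norm_num) (hstep k₀ le_rfl))
  refine ⟨l, (tendsto_add_atTop_iff_nat k₀).1 hl, fun k hk => ?_⟩
  have := dist_le_of_le_geometric_of_tendsto₀ (1 / 2) _ (by norm_num) (hstep k hk)
    ((tendsto_add_atTop_iff_nat k).2 ((tendsto_add_atTop_iff_nat k₀).1 hl))
  rw [zero_add, dist_eq_norm] at this
  exact this.trans_eq (by ring)

/-- A sequence which comes close, for each `k`, to the vector `s k` of a sequence repeating every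
element of a dense set infinitely often, has dense linear span. -/
theorem denseRange_linearCombination {E : Type*} [NormedAddCommGroup E] [NormedSpace ℝ E]
    {d : ℕ → E} (hd : DenseRange d) {α : ℕ → E} {φ : ℕ → ℕ} {C : ℝ}
    (h : ∀ k, ‖α (φ k) - d k.unpair.1‖ ≤ C * (1 / 2) ^ k) :
    DenseRange (Finsupp.linearCombination ℝ α) := by
  refine Metric.denseRange_iff.2 fun x r hr => ?_
  obtain ⟨j, hj⟩ := hd.exists_dist_lt x (half_pos hr)
  have h0 : Tendsto (fun k : ℕ => C * (1 / 2 : ℝ) ^ k) atTop (𝓝 0) := by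
    simpa using (tendsto_pow_atTop_nhds_zero_of_lt_one (r := (1 / 2 : ℝ)) (by norm_num)
      (by norm_num)).const_mul C
  obtain ⟨m, hm⟩ := eventually_atTop.1 (h0.eventually_lt_const (half_pos hr))
  have h1 := (h (Nat.pair j m)).trans_lt (hm _ (Nat.right_le_pair j m))
  rw [Nat.unpair_pair] at h1
  refine ⟨Finsupp.single (φ (Nat.pair j m)) 1, ?_⟩
  rw [Finsupp.linearCombination_single, one_smul]
  refine (dist_triangle _ (d j) _).trans_lt ?_
  rw [dist_comm (d j), dist_eq_norm (α _)]
  linarith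

section

variable {G H : Type*} [NormedAddCommGroup G] [NormedSpace ℝ G]
  [NormedAddCommGroup H] [NormedSpace ℝ H]

/-- One step of the back-and-forth construction: from almost isometric tuples of length `2 * k`
in `G` and `H`, improve the almost isometry, making one given vector of `G` correspond to some
vector of `H`, and conversely. -/
theorem AlmostExtension.exists_step (hG : AlmostExtension G) (hH : AlmostExtension H)
    (x : G) (x' : H) (k : ℕ) {δ : ℝ} (hδ : 0 < δ) {a : ℕ → G} {b : ℕ → H}
    (h : AlmostIsometric (2 * k) δ a b) :
    ∃ a' : ℕ → G, ∃ b' : ℕ → H, AlmostIsometric (2 * (k + 1)) (δ / 2) a' b' ∧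
      (∀ i < 2 * k, ‖a' i - a i‖ ≤ 2 * δ ∧ ‖b' i - b i‖ ≤ 2 * δ) ∧
      ‖a' (2 * k) - x‖ ≤ 2 * δ ∧ ‖b' (2 * k + 1) - x'‖ ≤ 2 * δ := by
  obtain ⟨b₁, hb₁, hb₁'⟩ := hH.exists_tuple (t := Function.update a (2 * k) x) hδ.le
    (n := 2 * k) (a := b) (δ := δ)
    (h.congr_left fun i hi => Function.update_of_ne hi.ne _ _).symm (2 * k + 1) (half_pos hδ)
  obtain ⟨a₁, ha₁, ha₁'⟩ := hG.exists_tuple (half_pos hδ).le (N := 2 * (k + 1))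
    (hb₁.symm.congr_right (b' := Function.update b₁ (2 * k + 1) x')
      fun i hi => Function.update_of_ne hi.ne _ _) (half_pos hδ)
  refine ⟨a₁, _, ha₁, fun i hi => ⟨?_, ?_⟩, ?_, ?_⟩
  · have := ha₁' i (by omega)
    rw [Function.update_of_ne hi.ne] at this
    linarith
  · rw [Function.update_of_ne (by omega)]
    linarith [hb₁' i hi]
  · have := ha₁' (2 * k) (by omega)
    rw [Function.update_self] at this
    linarith
  · rw [Function.update_self, sub_self, norm_zero]
    linarith

/-- Two separable Banach spaces with the tuple extension property are isometric, by a
back-and-forth argument. -/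
theorem AlmostExtension.nonempty_linearIsometryEquiv [CompleteSpace G] [CompleteSpace H]
    [TopologicalSpace.SeparableSpace G] [TopologicalSpace.SeparableSpace H]
    (hG : AlmostExtension G) (hH : AlmostExtension H) : Nonempty (G ≃ₗᵢ[ℝ] H) := by
  obtain ⟨d, hd⟩ := TopologicalSpace.exists_dense_seq G
  obtain ⟨d', hd'⟩ := TopologicalSpace.exists_dense_seq H
  -- `d (k.unpair.1)` takes each value `d j` for infinitely many `k`, so that every `d j` is handled
  -- with arbitrarily small error
  let S (k : ℕ) := {s : (ℕ → G) × (ℕ → H) // AlmostIsometric (2 * k) ((1 / 2) ^ k) s.1 s.2}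
  let s₀ : S 0 := ⟨0, by intro y; simp⟩
  have hstep : ∀ k (s : S k), ∃ s' : S (k + 1),
      (∀ i < 2 * k, ‖s'.1.1 i - s.1.1 i‖ ≤ 2 * (1 / 2) ^ k ∧
        ‖s'.1.2 i - s.1.2 i‖ ≤ 2 * (1 / 2) ^ k) ∧
      ‖s'.1.1 (2 * k) - d k.unpair.1‖ ≤ 2 * (1 / 2) ^ k ∧
      ‖s'.1.2 (2 * k + 1) - d' k.unpair.1‖ ≤ 2 * (1 / 2) ^ k := fun k s => by
    obtain ⟨a', b', h1, h2⟩ := hG.exists_step hH (d k.unpair.1) (d' k.unpair.1) k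
      (by positivity) s.2
    exact ⟨⟨(a', b'), by rwa [pow_succ, mul_one_div]⟩, h2⟩
  choose next hnext₁ hnext₂ hnext₃ using hstep
  let s : ∀ k, S k := fun k => Nat.rec s₀ next k
  have hs : ∀ k, s (k + 1) = next k (s k) := fun _ => rfl
  have hlimG : ∀ i, ∃ l, Tendsto (fun k => (s k).1.1 i) atTop (𝓝 l) ∧
      ∀ k ≥ i / 2 + 1, ‖(s k).1.1 i - l‖ ≤ 2 * 2 * (1 / 2) ^ k := fun i =>
    exists_limit_of_norm_sub_le fun k hk => by
      rw [hs]; exact (hnext₁ k (s k) i (by omega)).1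
  have hlimH : ∀ i, ∃ l, Tendsto (fun k => (s k).1.2 i) atTop (𝓝 l) ∧
      ∀ k ≥ i / 2 + 1, ‖(s k).1.2 i - l‖ ≤ 2 * 2 * (1 / 2) ^ k := fun i =>
    exists_limit_of_norm_sub_le fun k hk => by
      rw [hs]; exact (hnext₁ k (s k) i (by omega)).2
  choose α hα hα' using hlimG
  choose β hβ hβ' using hlimH
  have hiso : ∀ n, AlmostIsometric n 0 α β := fun n y => by
    have h1 : Tendsto (fun k => |‖∑ i ∈ range n, y i • (s k).1.1 i‖
        - ‖∑ i ∈ range n, y i • (s k).1.2 i‖|) atTop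
        (𝓝 |‖∑ i ∈ range n, y i • α i‖ - ‖∑ i ∈ range n, y i • β i‖|) :=
      ((tendsto_finsetSum _ fun i _ => (hα i).const_smul (y i)).norm.sub
        (tendsto_finsetSum _ fun i _ => (hβ i).const_smul (y i)).norm).abs
    have h2 : Tendsto (fun k : ℕ => (1 / 2 : ℝ) ^ k * ∑ i ∈ range n, |y i|) atTop
        (𝓝 (0 * ∑ i ∈ range n, |y i|)) :=
      (tendsto_pow_atTop_nhds_zero_of_lt_one (by norm_num) (by norm_num)).mul_const _
    refine le_of_tendsto_of_tendsto h1 h2 (eventually_atTop.2 ⟨n, fun k hk => ?_⟩)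
    exact (s k).2.mono_left (by omega) y
  have hdG : DenseRange (Finsupp.linearCombination ℝ α) :=
    denseRange_linearCombination (C := 4) (φ := fun k => 2 * k) hd fun k => by
      have h1 := hα' (2 * k) (k + 1) (by omega)
      have h2 := hnext₂ k (s k)
      rw [← hs] at h2
      have h3 := norm_sub_le_norm_sub_add_norm_sub (α (2 * k)) ((s (k + 1)).1.1 (2 * k))
        (d k.unpair.1)
      rw [norm_sub_rev (α _) ((s (k + 1)).1.1 (2 * k))] at h3
      have h4 := pow_succ (1 / 2 : ℝ) k
      linarith
  have hdH : DenseRange (Finsupp.linearCombination ℝ β) :=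
    denseRange_linearCombination (C := 4) (φ := fun k => 2 * k + 1) hd' fun k => by
      have h1 := hβ' (2 * k + 1) (k + 1) (by omega)
      have h2 := hnext₃ k (s k)
      rw [← hs] at h2
      have h3 := norm_sub_le_norm_sub_add_norm_sub (β (2 * k + 1))
        ((s (k + 1)).1.2 (2 * k + 1)) (d' k.unpair.1)
      rw [norm_sub_rev (β _) ((s (k + 1)).1.2 (2 * k + 1))] at h3
      have h4 := pow_succ (1 / 2 : ℝ) k
      linarith
  refine ⟨(LinearEquiv.refl ℝ (ℕ →₀ ℝ)).extendOfIsometry _ _ hdG hdH fun x => ?_⟩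
  obtain ⟨n, hn⟩ := x.support.exists_nat_subset_range
  rw [LinearEquiv.refl_apply, Finsupp.linearCombination_apply, Finsupp.linearCombination_apply,
    Finsupp.sum_of_support_subset x hn _ (by simp), Finsupp.sum_of_support_subset x hn _ (by simp)]
  exact ((hiso n).norm_eq x).symm

theorem IsGurarii.nonempty_linearIsometryEquiv (hG : IsGurarii G) (hH : IsGurarii H) :
    Nonempty (G ≃ₗᵢ[ℝ] H) := by
  have := hG.complete
  have := hG.separable
  have := hH.complete
  have := hH.separable
  exact hG.almostExtension.nonempty_linearIsometryEquiv hH.almostExtension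

end

/-! ### The topology of the space of pseudonorms -/

namespace PseudoNorm

theorem continuous_apply (v : RatSeq) : Continuous fun μ : PseudoNorm => μ v :=
  (_root_.continuous_apply v).comp continuous_induced_dom

theorem continuous_weight (x : RealSeq) : Continuous fun μ : PseudoNorm => weight μ x :=
  continuous_finsetSum _ fun _ _ => continuous_const.mul (continuous_apply _)

theorem abs_ext_sub_le (μ : PseudoNorm) (x : RealSeq) (v : RatSeq) :
    |μ.ext x - μ v| ≤ weight μ (x - incl v) := by
  rw [← ext_incl]
  exact (abs_sub_map_le_sub μ.ext x (incl v)).trans (extFun_le_weight μ _)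

theorem continuous_ext (x : RealSeq) : Continuous fun μ : PseudoNorm => μ.ext x := by
  refine continuous_iff_continuousAt.2 fun μ₀ => Metric.tendsto_nhds.2 fun ε hε => ?_
  obtain ⟨v, hv⟩ := exists_weight_sub_lt μ₀ x (show 0 < ε / 3 by linarith)
  filter_upwards [((continuous_weight (x - incl v)).tendsto μ₀).eventually_lt_const hv,
    Metric.tendsto_nhds.1 ((continuous_apply v).tendsto μ₀) (ε / 3) (by linarith)] with μ h1 h2
  have h3 := abs_le.1 (abs_ext_sub_le μ x v)
  have h4 := abs_le.1 (abs_ext_sub_le μ₀ x v)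
  rw [Real.dist_eq] at h2 ⊢
  have h5 := abs_lt.1 h2
  rw [abs_lt]
  constructor <;> linarith

theorem isClosedEmbedding_coe :
    IsClosedEmbedding fun (μ : PseudoNorm) (v : RatSeq) => μ v := by
  refine ⟨⟨⟨rfl⟩, DFunLike.coe_injective⟩, ?_⟩
  have : (Set.range fun (μ : PseudoNorm) (v : RatSeq) => μ v)
      = {f | ∀ v w, f (v + w) ≤ f v + f w} ∩ {f | ∀ (q : ℚ) v, f (q • v) = ‖q‖ * f v} := by
    refine Set.Subset.antisymm ?_ fun f hf => ⟨Seminorm.of f hf.1 hf.2, rfl⟩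
    rintro _ ⟨μ, rfl⟩
    exact ⟨map_add_le_add μ, map_smul_eq_mul μ⟩
  rw [this]
  refine IsClosed.inter ?_ ?_
  · simp only [Set.ofPred_forall]
    exact isClosed_iInter fun v => isClosed_iInter fun w => isClosed_le (by fun_prop) (by fun_prop)
  · simp only [Set.ofPred_forall]
    exact isClosed_iInter fun q => isClosed_iInter fun v => isClosed_eq (by fun_prop) (by fun_prop)

instance : PolishSpace PseudoNorm := isClosedEmbedding_coe.polishSpace

/-- Close pseudonorms induce uniformly close norms on every finite-dimensional subspace
of `c₀₀`. -/
theorem eventually_almostIsometric (μ₀ : PseudoNorm) (w : ℕ → RealSeq) (n : ℕ) {η : ℝ}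
    (hη : 0 < η) : ∀ᶠ μ : PseudoNorm in 𝓝 μ₀,
      AlmostIsometric n η (fun i => μ.toSpace (w i)) (fun i => μ₀.toSpace (w i)) := by
  let S : (ℕ → ℝ) → RealSeq := fun y => ∑ i ∈ range n, y i • w i
  have hloc : ∀ y₀ : ℕ → ℝ, ∀ᶠ z : PseudoNorm × (ℕ → ℝ) in 𝓝 (μ₀, y₀),
      |z.1.ext (S z.2) - μ₀.ext (S z.2)| < η := fun y₀ => by
    -- a continuous majorant which vanishes at `(μ₀, y₀)`
    let Φ : PseudoNorm × (ℕ → ℝ) → ℝ := fun z =>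
      ∑ i ∈ range n, |z.2 i - y₀ i| * (z.1.ext (w i) + μ₀.ext (w i))
        + |z.1.ext (S y₀) - μ₀.ext (S y₀)|
    have hΦ : Continuous Φ := by
      have := fun x => (continuous_ext x).comp (continuous_fst (X := PseudoNorm) (Y := ℕ → ℝ))
      simp only [Function.comp_def] at this
      fun_prop
    have hΦ0 : Φ (μ₀, y₀) < η := by simpa [Φ] using hη
    filter_upwards [(hΦ.tendsto _).eventually_lt_const hΦ0] with z hz
    refine lt_of_le_of_lt ?_ hz
    have hlip : ∀ μ : PseudoNorm, |μ.ext (S z.2) - μ.ext (S y₀)|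
        ≤ ∑ i ∈ range n, |z.2 i - y₀ i| * μ.ext (w i) := fun μ => by
      refine (abs_sub_map_le_sub μ.ext _ _).trans ?_
      simp only [S, ← norm_toSpace, ← sum_sub_distrib, ← sub_smul, map_sum, map_smul]
      exact norm_sum_le_of_le _ fun i _ => (norm_smul _ _).le
    have h1 := abs_le.1 (hlip z.1)
    have h2 := abs_le.1 (hlip μ₀)
    have h3 := abs_le.1 (le_refl |z.1.ext (S y₀) - μ₀.ext (S y₀)|)
    simp only [Φ, mul_add, sum_add_distrib]
    rw [abs_le]
    constructor <;> linarith
  have hK : IsCompact (Set.pi Set.univ fun _ : ℕ => Set.Icc (-1 : ℝ) 1) :=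
    isCompact_univ_pi fun _ => isCompact_Icc
  filter_upwards [hK.eventually_forall_of_forall_eventually
    (P := fun (μ : PseudoNorm) y => |μ.ext (S y) - μ₀.ext (S y)| < η)
    fun y _ => hloc y] with μ hμ y
  rw [sum_smul_toSpace, sum_smul_toSpace, norm_toSpace, norm_toSpace]
  change |μ.ext (S y) - μ₀.ext (S y)| ≤ _
  -- scale `y` into the compact cube
  set s := ∑ i ∈ range n, |y i| with hs
  have hy : ∀ i < n, |y i| ≤ s := fun i hi =>
    single_le_sum (f := fun i => |y i|) (fun _ _ => abs_nonneg _) (mem_range.2 hi)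
  have hs0 : 0 ≤ s := sum_nonneg fun _ _ => abs_nonneg _
  rcases hs0.eq_or_lt with h0 | h0
  · have : S y = 0 := sum_eq_zero fun i hi => by
      have := hy i (mem_range.1 hi)
      rw [← h0, abs_nonpos_iff] at this
      rw [this, zero_smul]
    simp [this, ← h0]
  · let z : ℕ → ℝ := fun i => if i < n then s⁻¹ * y i else 0
    have hz : S z = s⁻¹ • S y := by
      simp only [S, smul_sum, smul_smul]
      exact sum_congr rfl fun i hi => by simp only [z, if_pos (mem_range.1 hi)]
    have hzK : z ∈ Set.pi Set.univ fun _ : ℕ => Set.Icc (-1 : ℝ) 1 := fun i _ => by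
      rw [Set.mem_Icc, ← abs_le]
      by_cases hi : i < n
      · simp only [z, if_pos hi]
        rw [abs_mul, abs_inv, abs_of_pos h0]
        exact inv_mul_le_one_of_le₀ (hy i hi) hs0
      · simp [z, if_neg hi]
    have := (hμ z hzK).le
    rw [hz, map_smul_eq_mul, map_smul_eq_mul, ← mul_sub, abs_mul, norm_inv,
      Real.norm_of_nonneg hs0, abs_inv, abs_of_pos h0, inv_mul_le_iff₀ h0, mul_comm] at this
    exact this

/-! ### Genericity of the extension property -/

/-- One instance of the tuple extension property of `X_μ`, for a tuple of images of elements
of `c₀₀`, with open inequalities in its conclusion. -/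
def extensionSet (ν : PseudoNorm) (a : ℕ → RealSeq) (n N : ℕ) (δ ε : ℝ) : Set PseudoNorm :=
  {μ | AlmostIsometric n δ (fun i => μ.toSpace (a i)) ν.unitVec →
    ∃ w : ℕ → RealSeq, (∃ η < ε, AlmostIsometric N η (fun i => μ.toSpace (w i)) ν.unitVec) ∧
      ∀ i < n, μ.ext (w i - a i) < δ + ε}

theorem isOpen_extensionSet (ν : PseudoNorm) (a : ℕ → RealSeq) (n N : ℕ) (δ ε : ℝ) :
    IsOpen (extensionSet ν a n N δ ε) := by
  refine isOpen_iff_eventually.2 fun μ₀ hμ₀ => ?_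
  by_cases hP : AlmostIsometric n δ (fun i => μ₀.toSpace (a i)) ν.unitVec
  · obtain ⟨w, ⟨η, hη, hw⟩, hwa⟩ := hμ₀ hP
    have h1 : ∀ᶠ μ : PseudoNorm in 𝓝 μ₀, ∀ i ∈ Set.Iio n, μ.ext (w i - a i) < δ + ε :=
      (eventually_all_finite (Set.finite_Iio n)).2 fun i hi =>
        ((continuous_ext (w i - a i)).tendsto μ₀).eventually_lt_const (hwa i hi)
    filter_upwards [h1, eventually_almostIsometric μ₀ w N (half_pos (sub_pos.2 hη))]
      with μ h1 h2 _
    exact ⟨w, ⟨_, by linarith, h2.trans hw⟩, h1⟩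
  · have hc : IsClosed {μ : PseudoNorm |
        AlmostIsometric n δ (fun i => μ.toSpace (a i)) ν.unitVec} := by
      simp only [AlmostIsometric, sum_smul_toSpace, norm_toSpace, Set.ofPred_forall]
      exact isClosed_iInter fun y => isClosed_le
        (((continuous_ext _).sub continuous_const).abs) continuous_const
    filter_upwards [hc.isOpen_compl.mem_nhds hP] with μ hμ h
    exact absurd h hμ

theorem toSpace_eq_linearCombination (μ : PseudoNorm) :
    μ.toSpace = Finsupp.linearCombination ℝ μ.unitVec := by
  ext i
  simp [unitVec]

theorem ext_ofTuple {W : Type*} [AddCommGroup W] [Module ℝ W] (p : Seminorm ℝ W) (t : ℕ → W)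
    (x : RealSeq) : (ofTuple p t).ext x = p (Finsupp.linearCombination ℝ t x) := by
  rw [ofTuple, ext_restrict, Seminorm.comp_apply]

/-- Given `μ₀`, amalgamate `X_μ₀` with `X_ν` and keep the first `K` unit vectors of `X_μ₀`,
followed by those of `X_ν`. This gives pseudonorms in the extension set which converge to `μ₀` as
`K → ∞`. -/
theorem dense_extensionSet (ν : PseudoNorm) (a : ℕ → RealSeq) (n N : ℕ) {δ ε : ℝ} (hδ : 0 ≤ δ)
    (hε : 0 < ε) : Dense (extensionSet ν a n N δ ε) := by
  intro μ₀
  by_cases hP : AlmostIsometric n δ (fun i => μ₀.toSpace (a i)) ν.unitVec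
  swap
  · exact subset_closure fun h => absurd h hP
  obtain ⟨p, hp1, hp2, hp3⟩ := hP.exists_amalgam hδ
  let t (K : ℕ) : ℕ → μ₀.Space × ν.Space := fun i =>
    if i < K then (μ₀.unitVec i, 0) else (0, ν.unitVec (i - K))
  have ht1 : ∀ K (x : RealSeq), x.support ⊆ range K →
      Finsupp.linearCombination ℝ (t K) x = (μ₀.toSpace x, 0) := fun K x hx => by
    rw [toSpace_eq_linearCombination, Finsupp.linearCombination_apply,
      Finsupp.linearCombination_apply, Finsupp.sum_of_support_subset x hx _ (by simp),
      Finsupp.sum_of_support_subset x hx _ (by simp),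
      sum_congr rfl fun i hi => by rw [show t K i = _ from if_pos (mem_range.1 hi)]]
    ext <;> simp [Prod.fst_sum, Prod.snd_sum]
  have ht2 : ∀ K i, t K (K + i) = (0, ν.unitVec i) := fun K i => by simp [t]
  let ρ (K : ℕ) : PseudoNorm := ofTuple p (t K)
  refine mem_closure_of_tendsto (f := ρ) (b := atTop) ?_ ?_
  · refine isClosedEmbedding_coe.isInducing.tendsto_nhds_iff.2 (tendsto_pi_nhds.2 fun v => ?_)
    obtain ⟨K₀, hK₀⟩ := (incl v).support.exists_nat_subset_range
    refine tendsto_const_nhds.congr' (eventually_atTop.2 ⟨K₀, fun K hK => ?_⟩)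
    change μ₀ v = ρ K v
    rw [← ext_incl, ← ext_incl, ext_ofTuple,
      ht1 K _ (hK₀.trans (range_subset_range.2 hK)), hp1, norm_toSpace]
  · obtain ⟨K₀, hK₀⟩ := ((range n).biUnion fun i => (a i).support).exists_nat_subset_range
    refine eventually_atTop.2 ⟨K₀, fun K hK _ => ⟨fun i => Finsupp.single (K + i) 1,
      ⟨0, hε, .of_norm_eq fun y => ?_⟩, fun i hi => ?_⟩⟩
    · rw [sum_smul_toSpace, norm_toSpace, ext_ofTuple, map_sum]
      simp only [map_smul, Finsupp.linearCombination_single, one_smul, ht2]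
      rw [← hp2]
      congr 1
      ext <;> simp [Prod.fst_sum, Prod.snd_sum]
    · have hai : (a i).support ⊆ range K :=
        ((subset_biUnion_of_mem (fun i => (a i).support) (mem_range.2 hi)).trans hK₀).trans
          (range_subset_range.2 hK)
      rw [ext_ofTuple, map_sub, Finsupp.linearCombination_single, one_smul, ht2, ht1 K _ hai,
        map_sub_rev]
      refine lt_of_le_of_lt ?_ (lt_add_of_pos_right δ hε)
      simpa using hp3 i hi

/-- The extension property of `X_μ` amounts to countably many open conditions on `μ`. -/
theorem almostExtension_iff {D : Set PseudoNorm} (hD : Dense D) (μ : PseudoNorm) :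
    AlmostExtension μ.Space ↔ ∀ (ν : D) (a : ℕ →₀ RatSeq) (n N : ℕ) (δ : Set.Ici (0 : ℚ))
      (ε : Set.Ioi (0 : ℚ)), μ ∈ extensionSet ν (fun i => incl (a i)) n N (δ : ℚ) (ε : ℚ) := by
  constructor
  · rintro h ⟨ν, -⟩ a n N ⟨δ, hδ⟩ ⟨ε, hε⟩
    refine fun hP => ?_
    have hδ' : (0 : ℝ) ≤ δ := Rat.cast_nonneg.2 hδ
    have hε' : (0 : ℝ) < ε := Rat.cast_pos.2 hε
    obtain ⟨b, hb, hba⟩ := h ν _ n N δ (ε / 2) hδ' (half_pos hε') hP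
    choose w hw using fun i => μ.exists_toSpace_incl_lt (b i) (show (0 : ℝ) < ε / 4 by linarith)
    refine ⟨fun i => incl (w i), ⟨_, ?_, (AlmostIsometric.of_norm_sub_le
      fun i _ => (hw i).le).trans hb⟩, fun i hi => ?_⟩
    · dsimp only; linarith
    · rw [← norm_toSpace, map_sub]
      have := norm_sub_le_norm_sub_add_norm_sub (μ.toSpace (incl (w i))) (b i)
        (μ.toSpace (incl (a i)))
      dsimp only
      linarith [hba i hi, hw i]
  · intro h ν u n N δ ε hδ hε hP
    -- replace `ν` and `u` by `η`-close data from the countable families; the errors add up to at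
    -- most `6 * η`
    let η := ε / 8
    have hη : ε = 8 * η := by simp only [η]; ring
    have hη0 : 0 < η := by linarith
    have hU := eventually_almostIsometric ν (fun i => Finsupp.single i 1) (max n N) hη0
    obtain ⟨ν', hν', hν'D⟩ := (mem_closure_iff_nhds.1 (hD ν)) _ hU
    change AlmostIsometric (max n N) η ν'.unitVec ν.unitVec at hν'
    choose a ha using fun i => μ.exists_toSpace_incl_lt (u i) hη0
    obtain ⟨δ₁, hδ₁, hδ₁'⟩ := exists_rat_btwn (show δ + 2 * η < δ + 3 * η by linarith)
    obtain ⟨ε₁, hε₁, hε₁'⟩ := exists_rat_btwn (show η < 2 * η by linarith)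
    let a' : ℕ →₀ RatSeq := Finsupp.onFinset (range n) (fun i => if i < n then a i else 0)
      fun i hi => by by_contra h; simp_all
    have ha' : ∀ i < n, a' i = a i := fun i hi => by simp [a', hi]
    obtain ⟨w, ⟨η', hη', hw⟩, hwa⟩ := h ⟨ν', hν'D⟩ a' n N
      ⟨δ₁, by have : (0 : ℝ) ≤ δ₁ := by linarith
              exact_mod_cast this⟩
      ⟨ε₁, by have : (0 : ℝ) < ε₁ := by linarith
              exact_mod_cast this⟩
      ((((AlmostIsometric.of_norm_sub_le (δ := η) fun i hi => by
        simpa only [ha' i hi] using (ha i).le).trans hP).trans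
          (hν'.mono_left (le_max_left _ _)).symm).mono_right (by dsimp only; linarith))
    dsimp only at hη' hwa
    refine ⟨fun i => μ.toSpace (w i),
      (hw.trans (hν'.mono_left (le_max_right _ _))).mono_right (by linarith), fun i hi => ?_⟩
    have h1 := hwa i hi
    rw [← norm_toSpace, map_sub, ha' i hi] at h1
    have := norm_sub_le_norm_sub_add_norm_sub (μ.toSpace (w i)) (μ.toSpace (incl (a i))) (u i)
    linarith [ha i]

/-- The set of pseudonorms which are norms on the span of the first `n` unit vectors. -/
def normSet (n : ℕ) : Set PseudoNorm :=
  {μ | ∃ ε > 0, ∀ y : ℕ → ℝ, ε * ∑ i ∈ range n, |y i| ≤ ‖∑ i ∈ range n, y i • μ.unitVec i‖}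

theorem isOpen_normSet (n : ℕ) : IsOpen (normSet n) := by
  refine isOpen_iff_eventually.2 fun μ₀ ⟨ε, hε, h⟩ => ?_
  filter_upwards [eventually_almostIsometric μ₀ (fun i => Finsupp.single i 1) n (half_pos hε)]
    with μ hμ
  refine ⟨ε / 2, half_pos hε, fun y => ?_⟩
  have h1 := (abs_le.1 (hμ y)).1
  have h2 := h y
  simp only [unitVec] at h2 ⊢
  linarith

/-- The `ℓ₁`-norm on `c₀₀`. -/
def l1Norm : Seminorm ℝ RealSeq :=
  -- all unit vectors have weight one for this pseudonorm
  let μ := ofTuple (normSeminorm ℝ ℝ) fun _ => 1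
  Seminorm.of (weight μ) (weight_add_le μ) (weight_smul μ)

theorem l1Norm_apply (x : RealSeq) : l1Norm x = x.sum fun _ r => |r| := by
  refine Finset.sum_congr rfl fun i _ => ?_
  have h : ofTuple (normSeminorm ℝ ℝ) (fun _ => 1) (Finsupp.single i 1) = 1 := by
    rw [← ext_incl, ext_ofTuple]
    simp [incl]
  dsimp only
  rw [h, mul_one]

/-- Perturb by small multiples of the `ℓ₁`-norm. -/
theorem dense_normSet (n : ℕ) : Dense (normSet n) := by
  intro μ₀
  let c (k : ℕ) : NNReal := 1 / ((k : NNReal) + 1)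
  refine mem_closure_of_tendsto (f := fun k => restrict (μ₀.ext + c k • l1Norm)) (b := atTop)
    ?_ (Eventually.of_forall fun k => ⟨c k, ?_, fun y => ?_⟩)
  · refine isClosedEmbedding_coe.isInducing.tendsto_nhds_iff.2 (tendsto_pi_nhds.2 fun v => ?_)
    have h0 : Tendsto (fun k => (c k : ℝ)) atTop (𝓝 0) := by
      simpa [c] using tendsto_one_div_add_atTop_nhds_zero_nat (𝕜 := ℝ)
    have h1 := (h0.mul_const (l1Norm (incl v))).const_add (μ₀.ext (incl v))
    rw [zero_mul, add_zero, ext_incl] at h1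
    exact h1.congr fun k => by rw [← ext_incl μ₀]; rfl
  · positivity
  · simp only [unitVec]
    rw [sum_smul_toSpace, norm_toSpace, ext_restrict]
    have h1 : l1Norm (∑ i ∈ range n, y i • Finsupp.single i 1) = ∑ i ∈ range n, |y i| := by
      rw [l1Norm_apply, Finsupp.sum_of_support_subset (s := range n) _ _ _ (by simp)]
      · refine sum_congr rfl fun i hi => ?_
        simp [Finsupp.finsetSum_apply, Finsupp.single_apply, mem_range.1 hi]
      · intro i
        simp only [Finsupp.mem_support_iff, Finsupp.finsetSum_apply]
        intro h
        obtain ⟨j, hj, hj'⟩ := exists_ne_zero_of_sum_ne_zero h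
        simp [Finsupp.single_apply] at hj'
        exact hj'.1 ▸ hj
    change _ ≤ μ₀.ext _ + c k • l1Norm _
    rw [h1]
    exact le_add_of_nonneg_left (apply_nonneg _ _)

/-- If the extension of `μ` is a norm, then `c₀₀` embeds in `X_μ`, which is therefore
infinite-dimensional. -/
theorem mem_norms_of_forall_mem_normSet {μ : PseudoNorm} (h : ∀ n, μ ∈ normSet n) :
    μ ∈ norms := by
  have h0 : ∀ x : RealSeq, μ.ext x = 0 → x = 0 := fun x hx => by
    obtain ⟨n, hn⟩ := x.support.exists_nat_subset_range
    obtain ⟨ε, hε, hy⟩ := h n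
    have h1 := hy x
    rw [← norm_toSpace, toSpace_eq_linearCombination, Finsupp.linearCombination_apply,
      Finsupp.sum_of_support_subset x hn _ (by simp)] at hx
    rw [hx] at h1
    have h2 : ∑ i ∈ range n, |x i| ≤ 0 := by
      by_contra! h
      nlinarith [mul_pos hε h]
    ext i
    by_contra hi
    have h3 := single_le_sum (f := fun i => |x i|) (fun _ _ => abs_nonneg _)
      (hn (Finsupp.mem_support_iff.2 hi))
    exact hi (abs_nonpos_iff.1 (h3.trans h2))
  refine ⟨fun hfin => ?_, h0⟩
  have hinj : Function.Injective μ.toSpace := (injective_iff_map_eq_zero _).2 fun x hx =>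
    h0 x (by rw [← norm_toSpace, hx, norm_zero])
  have : FiniteDimensional ℝ μ.Space := hfin
  have : FiniteDimensional ℝ RealSeq := .of_injective _ hinj
  exact not_finite_iff_infinite.2 (inferInstanceAs (Infinite ℕ))
    (Module.Finite.finite_basis (Finsupp.basisSingleOne (R := ℝ) (ι := ℕ)))

theorem isGδ_almostExtension : IsGδ {μ : PseudoNorm | AlmostExtension μ.Space} := by
  obtain ⟨D, hDc, hD⟩ := TopologicalSpace.exists_countable_dense PseudoNorm
  have := hDc.to_subtype
  simp only [almostExtension_iff hD, Set.ofPred_forall, Set.ofPred_mem_eq]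
  refine .iInter fun ν => .iInter fun a => .iInter fun n => .iInter fun N => .iInter fun δ =>
    .iInter fun ε => (isOpen_extensionSet _ _ _ _ _ _).isGδ

/-- Norms whose completion has the extension property are dense, by Baire's theorem. -/
theorem dense_almostExtension_inter_norms :
    Dense ({μ : PseudoNorm | AlmostExtension μ.Space} ∩ norms) := by
  obtain ⟨D, hDc, hD⟩ := TopologicalSpace.exists_countable_dense PseudoNorm
  have := hDc.to_subtype
  have h1 : Dense (⋂ i : D × (ℕ →₀ RatSeq) × ℕ × ℕ × Set.Ici (0 : ℚ) × Set.Ioi (0 : ℚ),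
      extensionSet i.1 (fun j => incl (i.2.1 j)) i.2.2.1 i.2.2.2.1 (i.2.2.2.2.1 : ℚ)
        (i.2.2.2.2.2 : ℚ)) :=
    dense_iInter_of_isOpen (fun _ => isOpen_extensionSet _ _ _ _ _ _) fun i =>
      dense_extensionSet _ _ _ _ (Rat.cast_nonneg.2 i.2.2.2.2.1.2) (Rat.cast_pos.2 i.2.2.2.2.2.2)
  have h2 : Dense (⋂ n, normSet n) := dense_iInter_of_isOpen isOpen_normSet dense_normSet
  refine (h1.inter_of_Gδ (.iInter_of_isOpen fun _ => isOpen_extensionSet _ _ _ _ _ _)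
    (.iInter_of_isOpen isOpen_normSet) h2).mono fun μ hμ => ⟨?_, ?_⟩
  · exact (almostExtension_iff hD μ).2 fun ν a n N δ ε =>
      Set.mem_iInter.1 hμ.1 (ν, a, n, N, δ, ε)
  · exact mem_norms_of_forall_mem_normSet (Set.mem_iInter.1 hμ.2)

end PseudoNorm

end

/-- The Gurariĭ space exists and is unique up to linear isometry, and its isometry class is a
dense `Gδ` subset of each of `𝓟`, `𝓟_∞` and `𝓑`. -/
theorem mainTheorem4 :
    (∃ (G : Type) (_ : NormedAddCommGroup G) (_ : NormedSpace ℝ G), IsGurarii G) ∧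
    (∀ (G : Type*) (H : Type*) [NormedAddCommGroup G] [NormedSpace ℝ G]
      [NormedAddCommGroup H] [NormedSpace ℝ H],
      IsGurarii G → IsGurarii H → Nonempty (G ≃ₗᵢ[ℝ] H)) ∧
    (∀ (G : Type*) [NormedAddCommGroup G] [NormedSpace ℝ G], IsGurarii G →
      ∀ I ∈ ({Set.univ, PseudoNorm.infDim, PseudoNorm.norms} : Set (Set PseudoNorm)),
        IsGδ ((↑) ⁻¹' PseudoNorm.isometryClass I G : Set I) ∧
        Dense ((↑) ⁻¹' PseudoNorm.isometryClass I G : Set I)) := by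
  refine ⟨?_, fun G H _ _ _ _ hG hH => hG.nonempty_linearIsometryEquiv hH,
    fun G _ _ hG I hI => ?_⟩
  · obtain ⟨μ, hμ, -⟩ := PseudoNorm.dense_almostExtension_inter_norms.nonempty
    exact ⟨μ.Space, inferInstance, inferInstance, AlmostExtension.isGurarii hμ⟩
  · have hclass : ((↑) ⁻¹' PseudoNorm.isometryClass I G : Set I)
        = (↑) ⁻¹' {μ : PseudoNorm | AlmostExtension μ.Space} := by
      ext μ
      refine ⟨fun ⟨_, ⟨e⟩⟩ => hG.almostExtension.of_equiv e, fun h => ⟨μ.2, ?_⟩⟩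
      exact (AlmostExtension.isGurarii h).nonempty_linearIsometryEquiv hG
    have hnI : PseudoNorm.norms ⊆ I := by
      rcases hI with rfl | rfl | rfl
      exacts [Set.subset_univ _, fun μ hμ => hμ.1, subset_rfl]
    rw [hclass]
    refine ⟨PseudoNorm.isGδ_almostExtension.preimage continuous_subtype_val,
      Subtype.dense_iff.2 fun μ _ => ?_⟩
    refine closure_mono ?_ (PseudoNorm.dense_almostExtension_inter_norms μ)
    exact fun ν hν => ⟨⟨ν, hnI hν.2⟩, hν.1, rfl⟩
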